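/- Fix an integer $k\ge 1$. For a random variable $X$ with values in $\{0,1,2,\dots\}$ put $$\delta_k(X)=\Pr[X\le k-1],\qquad \mu_k(X)=\tfrac1k\,\mathbb E[\min(X,k)].$$ There is exactly one rate $\lambda_k\ge 0$ such that a Poisson random variable $X^{\lambda_k}$ with rate $\lambda_k$ satisfies $\delta_k(X^{\lambda_k})=\mu_k(X^{\lambda_k})$. Put $\phi_k:=\delta_k(X^{\lambda_k})=\mu_k(X^{\lambda_k})$. An instance $\mathcal F=(\mathcal F_1,\dots,\mathcal F_n)$ consists of finitely many atomless probability distributions on $[0,\infty)$ (not assumed to have finite mean). The values $v_t\sim\mathcal F_t$ of the $n$ buyers are independent. A seller with $k$ units posts a price $p\in\mathbb R$; buyers arrive one by one, and an arriving buyer takes a unit if and only if a unit is left and her value is at least $p$. Let $\mathrm{Welfare}(p,k,\mathcal F)\in[0,\infty]$ be the expected total value of the buyers who take a unit when they arrive in the order $1,\dots,n$, let $\mathrm{OPT}(k,\mathcal F)\in[0,\infty]$ be the expected sum of the $k$ highest values (of all values if $n<k$), and let $X_p=|\{t: v_t\ge p\}|$. 1. For every instance with $n>k$ there is a price $\bar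 p$ with $\delta_k(X_{\bar p})=\mu_k(X_{\bar p})$. 2. For every instance, every price $\bar p$ with $\delta_k(X_{\bar p})=\mu_k(X_{\bar p})$ satisfies $$\mathrm{Welfare}(\bar p,k,\mathcal F^\sigma)\ \ge\ \phi_k\cdot \mathrm{OPT}(k,\mathcal F)$$ for every order of arrival, i.e. for every permutation $\sigma$ of $\{1,\dots,n\}$, where $\mathcal F^\sigma=(\mathcal F_{\sigma(1)},\dots,\mathcal F_{\sigma(n)})$. In the trivial case $n\le k$ the price $\bar p=0$ satisfies this as well. 3. Consequently, let $\mathbf p$ be any static pricing scheme that assigns to each instance $\mathcal F$ a price $\mathbf p(k,\mathcal F)$ with $\delta_k(X_{\mathbf p(k,\mathcal F)})=\mu_k(X_{\mathbf p(k,\mathcal F)})$ or, where $n\le k$, possibly the price $0$ instead. Then its competitive ratio $$\inf_{\mathcal F}\ \frac{\mathrm{Welfare}(\mathbf p(k,\mathcal F),k,\mathcal F)}{\mathrm{OPT}(k,\mathcal F)},$$ the infimum being over all instances with $0<\mathrm{OPT}(k,\mathcal F)<\infty$, is at least $\phi_k$. -/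

import Mathlib

open MeasureTheory ProbabilityTheory
open scoped NNReal ENNReal

noncomputable section

namespace StaticPricing

/-- `δ_k(X) = Pr[X ≤ k - 1]` for an `ℕ`-valued random variable `X` on `(Ω, P)`;
the event is written `X < k`. -/
def delta {Ω : Type*} [MeasurableSpace Ω] (k : ℕ) (P : Measure Ω) (X : Ω → ℕ) : ℝ :=
  P.real {ω | X ω < k}

/-- `μ_k(X) = (1/k) E[min(X, k)]` for an `ℕ`-valued random variable `X` on `(Ω, P)`. -/
def mu {Ω : Type*} [MeasurableSpace Ω] (k : ℕ) (P : Measure Ω) (X : Ω → ℕ) : ℝ :=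
  (1 / (k : ℝ)) * ∫ ω, ((min (X ω) k : ℕ) : ℝ) ∂P

/-- The rate `lam` satisfies `δ_k(X^lam) = μ_k(X^lam)` for `X^lam` Poisson with rate `lam`. -/
def IsBalancedRate (k : ℕ) (lam : ℝ≥0) : Prop :=
  delta k (poissonMeasure lam) (fun x : ℕ => x) = mu k (poissonMeasure lam) (fun x : ℕ => x)

/-- A family of value distributions of `n` buyers: atomless probability measures on `ℝ`
supported on the non-negative reals. -/
structure IsBuyerFamily {n : ℕ} (F : Fin n → Measure ℝ) : Prop where
  prob : ∀ t, IsProbabilityMeasure (F t)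
  atomless : ∀ t x, F t {x} = 0
  nonneg : ∀ t, F t (Set.Iio 0) = 0

/-- The joint law of the independent values `v_t ∼ F t`. -/
def valueLaw {n : ℕ} (F : Fin n → Measure ℝ) : Measure (Fin n → ℝ) :=
  Measure.pi F

/-- `X_p = |{t : v_t ≥ p}|`. -/
def demand {n : ℕ} (p : ℝ) (v : Fin n → ℝ) : ℕ :=
  (Finset.univ.filter fun t => p ≤ v t).card

/-- The number of units still available after the first `t` buyers, in the order
`0, 1, …, n - 1`, have been offered a unit at price `p`, starting from `k` units: buyer `t`
takes a unit iff one is left and her value is at least `p`. -/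
def supply {n : ℕ} (p : ℝ) (k : ℕ) (v : Fin n → ℝ) : ℕ → ℕ
  | 0 => k
  | t + 1 =>
      if 0 < supply p k v t ∧ ∃ h : t < n, p ≤ v ⟨t, h⟩ then supply p k v t - 1
      else supply p k v t

/-- The total value of the buyers who purchase a unit. -/
def realizedWelfare {n : ℕ} (p : ℝ) (k : ℕ) (v : Fin n → ℝ) : ℝ :=
  ∑ t : Fin n, if 0 < supply p k v t ∧ p ≤ v t then v t else 0

/-- The expected welfare of the static price `p` with `k` units when the `t`-th arriving buyer
has value distribution `F t`; values are almost surely non-negative, and the expectation may be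
infinite. -/
def welfare {n : ℕ} (p : ℝ) (k : ℕ) (F : Fin n → Measure ℝ) : ℝ≥0∞ :=
  ∫⁻ v, ENNReal.ofReal (realizedWelfare p k v) ∂(valueLaw F)

/-- The sum of the `k` highest entries of `v` (of all entries if there are fewer than `k`):
sort in non-increasing order and add the first `k` terms. -/
def topSum {n : ℕ} (k : ℕ) (v : Fin n → ℝ) : ℝ :=
  (((Finset.univ.val.map v).sort (fun a b : ℝ => b ≤ a)).take k).sum

/-- The expected optimal welfare in hindsight. -/
def opt {n : ℕ} (k : ℕ) (F : Fin n → Measure ℝ) : ℝ≥0∞ :=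
  ∫⁻ v, ENNReal.ofReal (topSum k v) ∂(valueLaw F)

/-- `p` equalizes `δ_k(X_p)` and `μ_k(X_p)`. -/
def IsBalancedPrice {n : ℕ} (k : ℕ) (F : Fin n → Measure ℝ) (p : ℝ) : Prop :=
  delta k (valueLaw F) (demand p) = mu k (valueLaw F) (demand p)

/-- The prices the scheme may post on `k` units and `F`: any balanced price, or, in the trivial
case of at most `k` buyers (where there need be no balanced price), the price `0`. -/
def IsSchemePrice {n : ℕ} (k : ℕ) (F : Fin n → Measure ℝ) (p : ℝ) : Prop :=
  IsBalancedPrice k F p ∨ (n ≤ k ∧ p = 0)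

/-- A static pricing scheme: a price for every supply `k` and all distributions `F`. -/
abbrev PricingScheme : Type := ℕ → ∀ n : ℕ, (Fin n → Measure ℝ) → ℝ

/-- The competitive ratio of a static pricing scheme with supply `k`: the infimum of
welfare over optimum, over all instances for which this ratio is meaningful. -/
def compRatio (s : PricingScheme) (k : ℕ) : ℝ≥0∞ :=
  ⨅ (n : ℕ) (F : Fin n → Measure ℝ) (_ : IsBuyerFamily F) (_ : opt k F ≠ 0) (_ : opt k F ≠ ∞),
    welfare (s k n F) k F / opt k F

end StaticPricing

end

/-!
The law of the number `X_p` of buyers who can afford the price `p` enters the welfare in two places.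
The revenue is `p * E[min(X_p, k)] = μ_k(X_p) * (k * p)`, and a buyer finds a unit left with
probability at least `δ_k(X_p)`, independently of her own value, so the buyers' utilities add up to
at least `δ_k(X_p) * ∑ t, E[(v t - p)⁺]` (`realizedWelfare_ge`, `welfare_ge`). As the optimum is at
most `k * p + ∑ t, E[(v t - p)⁺]` (`opt_le`), a balanced price guarantees the fraction
`δ_k(X_p) = μ_k(X_p)` of it in every order of arrival (`IsBalancedPrice.delta_mul_opt_le`). Balanced
prices exist by the intermediate value theorem, the absence of atoms making `δ_k(X_p) - μ_k(X_p)`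
continuous in `p` (`exists_isBalancedPrice`).

It remains to compare this fraction with that of the balanced Poisson law
(`delta_poisson_le_delta`). A sum of independent Bernoulli variables is ultra-log-concave: its point
masses, divided by those of any Poisson law, form a log-concave sequence without internal zeros
(`isUltraLogConcave_demand`). Hence the places where they dominate the Poisson weights form an
interval (`IsUltraLogConcave.poisson_le`). Let `d j = Pr[X = j] - Pr[X^lam = j]`, with `lam` the
balanced rate. If `X` were balanced with a smaller `δ_k`, then `∑_{j < k} d j < 0`, so `d` is
positive somewhere at or above `k`, and on `j < k` its sign changes at most once, from minus to
plus. Since the weights `k - j` decrease, `∑_{j < k} (k - j) * d j ≤ 0`, which says that `μ_k` of `X` is at least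
that of the Poisson law, a contradiction.
-/

namespace StaticPricing

/-! ### Ultra-log-concave sequences -/

/-- A non-negative sequence `p` is ultra-log-concave if `a j = j! * p j` is log-concave without
internal zeros. Both requirements are expressed by `a i * a (j + 2) ≤ a (i + 1) * a (j + 1)` for
all `i ≤ j`. -/
structure IsUltraLogConcave (p : ℕ → ℝ) : Prop where
  nonneg : ∀ j, 0 ≤ p j
  mul_le_mul : ∀ i j, i ≤ j →
    (i.factorial * p i) * ((j + 2).factorial * p (j + 2)) ≤
      ((i + 1).factorial * p (i + 1)) * ((j + 1).factorial * p (j + 1))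

/-- Convolution with a Bernoulli law preserves ultra-log-concavity. In terms of the sequences
`j! * p j` the convolution reads `a (j + 1) ↦ (1 - q) * a (j + 1) + q * (j + 1) * a j`, and the
required inequality holds separately for the coefficients of `(1 - q) ^ 2`, `(1 - q) * q` and
`q ^ 2`. -/
theorem IsUltraLogConcave.bernoulli_conv {p p' : ℕ → ℝ} (hp : IsUltraLogConcave p) {q : ℝ}
    (hq0 : 0 ≤ q) (hq1 : q ≤ 1) (h0 : p' 0 = (1 - q) * p 0)
    (hs : ∀ j, p' (j + 1) = (1 - q) * p (j + 1) + q * p j) : IsUltraLogConcave p' := by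
  obtain ⟨u, hu⟩ : ∃ u, u = 1 - q := ⟨_, rfl⟩
  have hu0 : 0 ≤ u := by linarith
  rw [← hu] at h0
  simp only [← hu] at hs
  obtain ⟨a, ha⟩ : ∃ a : ℕ → ℝ, ∀ j, a j = j.factorial * p j := ⟨_, fun _ => rfl⟩
  have hb0 : ((0 : ℕ).factorial : ℝ) * p' 0 = u * a 0 := by rw [ha, h0]; ring
  have hbs : ∀ j, ((j + 1).factorial : ℝ) * p' (j + 1) = u * a (j + 1) + q * ((j + 1) * a j) := by
    intro j
    rw [ha, ha, hs, Nat.factorial_succ]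
    push_cast
    ring
  have a0 : ∀ j, 0 ≤ a j := fun j => by rw [ha]; exact mul_nonneg (by positivity) (hp.nonneg j)
  have lc : ∀ i j, i ≤ j → a i * a (j + 1 + 1) ≤ a (i + 1) * a (j + 1) := fun i j hij => by
    simpa only [ha] using hp.mul_le_mul i j hij
  have lc' : ∀ i j, i ≤ j → a i * a (j + 1) ≤ a (i + 1) * a j := by
    intro i j hij
    rcases hij.eq_or_lt with rfl | h
    · rw [mul_comm]
    · obtain ⟨j, rfl⟩ : ∃ j', j = j' + 1 := ⟨j - 1, by omega⟩
      exact lc i j (by omega)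
  refine ⟨?_, ?_⟩
  · rintro (_ | j)
    · rw [h0]; exact mul_nonneg hu0 (hp.nonneg 0)
    · rw [hs]; exact add_nonneg (mul_nonneg hu0 (hp.nonneg _)) (mul_nonneg hq0 (hp.nonneg _))
  · intro i j hij
    rcases i with _ | i
    · rw [hb0, hbs 0, hbs (j + 1), hbs j]
      push_cast
      have e1 := mul_le_mul_of_nonneg_left (lc 0 j hij) (mul_nonneg hu0 hu0)
      have e2 := mul_le_mul_of_nonneg_left (lc' 0 j hij)
        (mul_nonneg (mul_nonneg hu0 hq0) (by positivity : (0 : ℝ) ≤ j + 1))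
      have e3 : 0 ≤ q * q * ((j + 1) * (a 0 * a j)) :=
        mul_nonneg (mul_nonneg hq0 hq0) (mul_nonneg (by positivity) (mul_nonneg (a0 _) (a0 _)))
      simp only [zero_add] at *
      linarith
    · rw [hbs, hbs (i + 1), hbs (j + 1), hbs j]
      push_cast
      have hij' : (i : ℝ) + 1 ≤ j := by exact_mod_cast hij
      have e1 := mul_le_mul_of_nonneg_left (lc (i + 1) j hij) (mul_nonneg hu0 hu0)
      have e2 := mul_le_mul_of_nonneg_left (lc' (i + 1) j hij)
        (mul_nonneg (mul_nonneg hu0 hq0) (by positivity : (0 : ℝ) ≤ j + 1))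
      have e3 := mul_le_mul_of_nonneg_left (lc i j (by omega))
        (mul_nonneg (mul_nonneg hu0 hq0) (by positivity : (0 : ℝ) ≤ i + 1))
      obtain ⟨j, rfl⟩ : ∃ j', j = j' + 1 := ⟨j - 1, by omega⟩
      push_cast at hij' e2 ⊢
      have hx : 0 ≤ a (i + 1) * a (j + 1) := mul_nonneg (a0 _) (a0 _)
      have e4 := mul_le_mul_of_nonneg_left
        (mul_le_mul_of_nonneg_left (lc i j (by omega))
          (by positivity : (0 : ℝ) ≤ (i + 1) * (j + 1 + 1 + 1)))
        (mul_nonneg hq0 hq0)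
      -- `(i + 1) * (j + 3) ≤ (i + 2) * (j + 2)`, the difference being `j + 1 - i`
      have e5 := mul_le_mul_of_nonneg_left
        (mul_le_mul_of_nonneg_right (by nlinarith :
          ((i : ℝ) + 1) * (j + 1 + 1 + 1) ≤ (i + 1 + 1) * (j + 1 + 1)) hx)
        (mul_nonneg hq0 hq0)
      linarith

/-- A log-concave sequence without internal zeros has no strict interior dip: it stays above the
level `c` between two places where it is at least `c`. -/
theorem le_of_logConcave {r : ℕ → ℝ} (r0 : ∀ j, 0 ≤ r j)
    (lc : ∀ i j, i ≤ j → r i * r (j + 2) ≤ r (i + 1) * r (j + 1)) {c : ℝ} {i j l : ℕ}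
    (hij : i ≤ j) (hjl : j ≤ l) (hi : c ≤ r i) (hl : c ≤ r l) : c ≤ r j := by
  by_contra! hj
  -- a dip forces a strict descent at some `s < j` and a strict ascent at some `t ≥ j`, and these
  -- two steps together contradict log-concavity
  have descent : ∃ s, i ≤ s ∧ s < j ∧ r (s + 1) < r s := by
    by_contra! h
    have : r i ≤ r j := Nat.le_induction (P := fun m _ => m ≤ j → r i ≤ r m) (fun _ => le_rfl)
      (fun m hm ih hmj => (ih (by omega)).trans (h m hm (by omega))) j hij le_rfl
    linarith
  have ascent : ∃ t, j ≤ t ∧ t < l ∧ r t < r (t + 1) := by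
    by_contra! h
    have : r l ≤ r j := Nat.le_induction (P := fun m _ => m ≤ l → r m ≤ r j) (fun _ => le_rfl)
      (fun m hm ih hml => (h m hm (by omega)).trans (ih (by omega))) l hjl le_rfl
    linarith
  obtain ⟨s, -, hsj, hs⟩ := descent
  obtain ⟨t, hjt, -, ht⟩ := ascent
  obtain ⟨t, rfl⟩ : ∃ t', t = t' + 1 := ⟨t - 1, by omega⟩
  have h1 := lc s t (by omega)
  have h2 : r s * r (t + 1) < r s * r (t + 2) :=
    mul_lt_mul_of_pos_left ht ((r0 _).trans_lt hs)
  have h3 : r (s + 1) * r (t + 1) ≤ r s * r (t + 1) := mul_le_mul_of_nonneg_right hs.le (r0 _)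
  linarith

/-- Where an ultra-log-concave sequence dominates the Poisson weights is an interval. -/
theorem IsUltraLogConcave.poisson_le {p : ℕ → ℝ} (hp : IsUltraLogConcave p) {lam : ℝ}
    (hlam : 0 < lam) {i j l : ℕ} (hij : i ≤ j) (hjl : j ≤ l)
    (hi : Real.exp (-lam) * lam ^ i / i.factorial ≤ p i)
    (hl : Real.exp (-lam) * lam ^ l / l.factorial ≤ p l) :
    Real.exp (-lam) * lam ^ j / j.factorial ≤ p j := by
  have key : ∀ m : ℕ, Real.exp (-lam) * lam ^ m / m.factorial ≤ p m ↔
      Real.exp (-lam) ≤ m.factorial * p m / lam ^ m := by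
    intro m
    rw [div_le_iff₀ (by positivity), le_div_iff₀ (by positivity), mul_comm (p m)]
  rw [key] at hi hl ⊢
  refine le_of_logConcave (r := fun m => m.factorial * p m / lam ^ m) (fun m => ?_)
    (fun s t hst => ?_) hij hjl hi hl
  · exact div_nonneg (mul_nonneg (by positivity) (hp.nonneg m)) (by positivity)
  · rw [div_mul_div_comm, div_mul_div_comm, ← pow_add, ← pow_add,
      show s + 1 + (t + 1) = s + (t + 2) by ring]
    exact div_le_div_of_nonneg_right (hp.mul_le_mul s t hst) (by positivity)

/-! ### The functionals `δ` and `μ` in terms of point masses -/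

section Functionals

variable {Ω : Type*} [MeasurableSpace Ω] {P : Measure Ω} [IsProbabilityMeasure P] {X : Ω → ℕ}

theorem delta_eq_sum (hX : Measurable X) (k : ℕ) :
    delta k P X = ∑ j ∈ Finset.range k, P.real {ω | X ω = j} := by
  induction k with
  | zero => simp [delta]
  | succ k ih =>
    rw [Finset.sum_range_succ, ← ih, delta, delta, ← measureReal_union]
    · congr 1
      ext ω
      simp only [Set.mem_ofPred_eq, Set.mem_union]
      omega
    · rw [Set.disjoint_left]
      intro ω h1 h2
      simp only [Set.mem_ofPred_eq] at h1 h2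
      omega
    · exact hX (measurableSet_singleton k)

/-- `E[min(X, k)] = k - ∑_{m < k} Pr[X ≤ m]`, divided by `k`. -/
theorem mu_eq_one_sub (hX : Measurable X) {k : ℕ} (hk : 0 < k) :
    mu k P X = 1 - (1 / (k : ℝ)) * ∑ m ∈ Finset.range k, delta (m + 1) P X := by
  have hmeas : ∀ m, MeasurableSet {ω | X ω < m} := fun m => hX (measurableSet_Iio (a := m))
  have hpt : ∀ ω, ((min (X ω) k : ℕ) : ℝ) =
      k - ∑ m ∈ Finset.range k, ({ω | X ω < m + 1}.indicator 1 ω : ℝ) := by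
    intro ω
    clear hk
    induction k with
    | zero => simp
    | succ k ih =>
      rw [Finset.sum_range_succ, ← sub_sub, Nat.cast_succ, add_sub_right_comm, ← ih]
      by_cases h : X ω < k + 1
      · rw [Set.indicator_of_mem (by exact h), min_eq_left (by omega), min_eq_left (by omega)]
        simp
      · rw [Set.indicator_of_notMem (by exact h), min_eq_right (by omega), min_eq_right (by omega)]
        push_cast
        ring
  have hint : ∀ m ∈ Finset.range k,
      Integrable (fun ω => ({ω | X ω < m + 1}.indicator 1 ω : ℝ)) P := fun m _ =>
    (integrable_const (1 : ℝ)).indicator (hmeas _)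
  have hk' : (k : ℝ) ≠ 0 := by positivity
  rw [mu]
  simp_rw [hpt]
  rw [integral_sub (integrable_const _) (integrable_finsetSum _ hint),
    integral_finsetSum _ hint]
  simp_rw [integral_indicator_one (hmeas _)]
  simp only [integral_const, probReal_univ, one_smul, delta]
  field_simp

/-- Summation by parts: the partial sums of `p` up to `k` count `p j` exactly `k - j` times. -/
theorem sum_sum_range_eq (p : ℕ → ℝ) (k : ℕ) :
    ∑ m ∈ Finset.range k, ∑ j ∈ Finset.range (m + 1), p j =
      ∑ j ∈ Finset.range k, ((k : ℝ) - j) * p j := by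
  induction k with
  | zero => simp
  | succ k ih =>
    rw [Finset.sum_range_succ, ih, Finset.sum_range_succ, Finset.sum_range_succ (n := k),
      ← add_assoc, ← Finset.sum_add_distrib]
    push_cast
    congr 1
    · exact Finset.sum_congr rfl fun j _ => by ring
    · ring

theorem mu_eq_sum (hX : Measurable X) {k : ℕ} (hk : 0 < k) :
    mu k P X =
      1 - (1 / (k : ℝ)) * ∑ j ∈ Finset.range k, ((k : ℝ) - j) * P.real {ω | X ω = j} := by
  rw [mu_eq_one_sub hX hk, ← sum_sum_range_eq]
  simp_rw [delta_eq_sum hX]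

end Functionals

/-- The point masses of the Poisson law, in the set-builder form that `delta_eq_sum` and `mu_eq_sum`
produce. -/
theorem poissonMeasure_real_setOf_eq (lam : ℝ≥0) (j : ℕ) :
    (poissonMeasure lam).real {x : ℕ | x = j} =
      Real.exp (-lam) * (lam : ℝ) ^ j / j.factorial := by
  rw [← poissonMeasure_real_singleton]
  rfl

theorem delta_poisson (k : ℕ) (lam : ℝ≥0) :
    delta k (poissonMeasure lam) (fun x : ℕ => x) =
      ∑ j ∈ Finset.range k, Real.exp (-lam) * (lam : ℝ) ^ j / j.factorial := by
  rw [delta_eq_sum (X := fun x : ℕ => x) measurable_id]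
  simp_rw [poissonMeasure_real_setOf_eq]

/-! ### Existence and uniqueness of the balanced Poisson rate -/

/-- The derivatives of the Poisson weights in the rate telescope. -/
theorem hasDerivAt_poisson_cdf (k : ℕ) (x : ℝ) :
    HasDerivAt (fun x : ℝ => ∑ j ∈ Finset.range (k + 1), Real.exp (-x) * x ^ j / j.factorial)
      (-(Real.exp (-x) * x ^ k / k.factorial)) x := by
  induction k with
  | zero => simpa using (hasDerivAt_neg x).exp
  | succ k ih =>
    have h := (((hasDerivAt_neg x).exp.mul (hasDerivAt_pow (k + 1) x)).div_const
      ((k + 1).factorial : ℝ))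
    have h2 := ih.add h
    simp_rw [Finset.sum_range_succ _ (k + 1)]
    convert! h2 using 1
    rw [Nat.factorial_succ]
    push_cast
    field_simp
    simp

theorem continuous_poisson_cdf (k : ℕ) :
    Continuous fun x : ℝ => ∑ j ∈ Finset.range k, Real.exp (-x) * x ^ j / j.factorial := by
  fun_prop

theorem strictAntiOn_poisson_cdf (k : ℕ) :
    StrictAntiOn (fun x : ℝ => ∑ j ∈ Finset.range (k + 1), Real.exp (-x) * x ^ j / j.factorial)
      (Set.Ici 0) := by
  refine strictAntiOn_of_deriv_neg (convex_Ici 0) (continuous_poisson_cdf _).continuousOn ?_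
  intro x hx
  rw [interior_Ici, Set.mem_Ioi] at hx
  rw [(hasDerivAt_poisson_cdf k x).deriv, neg_lt_zero]
  positivity

theorem tendsto_poisson_cdf (k : ℕ) :
    Filter.Tendsto (fun x : ℝ => ∑ j ∈ Finset.range k, Real.exp (-x) * x ^ j / j.factorial)
      Filter.atTop (nhds 0) := by
  have h : ∀ j ∈ Finset.range k, Filter.Tendsto
      (fun x : ℝ => Real.exp (-x) * x ^ j / j.factorial) Filter.atTop (nhds 0) := by
    intro j _
    have := (Real.tendsto_pow_mul_exp_neg_atTop_nhds_zero j).div_const (j.factorial : ℝ)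
    simpa [mul_comm] using this
  simpa using tendsto_finsetSum _ h

/-- `δ_k - μ_k` of the Poisson law of rate `x`, in a form that makes sense for every real `x`. -/
noncomputable def poissonGap (k : ℕ) (x : ℝ) : ℝ :=
  (∑ j ∈ Finset.range k, Real.exp (-x) * x ^ j / j.factorial) +
    (1 / (k : ℝ)) * (∑ m ∈ Finset.range k,
      ∑ j ∈ Finset.range (m + 1), Real.exp (-x) * x ^ j / j.factorial) - 1

theorem isBalancedRate_iff {k : ℕ} (hk : 0 < k) (lam : ℝ≥0) :
    IsBalancedRate k lam ↔ poissonGap k lam = 0 := by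
  rw [IsBalancedRate, mu_eq_one_sub (X := fun x : ℕ => x) measurable_id hk]
  simp_rw [delta_poisson]
  rw [poissonGap]
  constructor <;> intro h <;> linarith

theorem poisson_cdf_zero (k : ℕ) :
    ∑ j ∈ Finset.range (k + 1), Real.exp (-0) * (0 : ℝ) ^ j / j.factorial = 1 := by
  rw [Finset.sum_range_succ']
  simp

theorem poissonGap_zero {k : ℕ} (hk : 0 < k) : poissonGap k 0 = 1 := by
  obtain ⟨k, rfl⟩ : ∃ k', k = k' + 1 := ⟨k - 1, by omega⟩
  simp_rw [poissonGap, poisson_cdf_zero]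
  have : ((k + 1 : ℕ) : ℝ) ≠ 0 := by positivity
  simp only [Finset.sum_const, Finset.card_range, nsmul_eq_mul, mul_one]
  field_simp
  ring

theorem continuous_poissonGap (k : ℕ) : Continuous (poissonGap k) :=
  ((continuous_poisson_cdf k).add (continuous_const.mul
    (continuous_finsetSum _ fun _ _ => continuous_poisson_cdf _))).sub continuous_const

/-- `δ_k - μ_k` is a positive combination of Poisson distribution functions, up to a constant, and
each of these decreases in the rate. -/
theorem strictAntiOn_poissonGap {k : ℕ} (hk : 0 < k) :
    StrictAntiOn (poissonGap k) (Set.Ici 0) := by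
  intro x hx y hy hxy
  have h1 : ∀ m, (∑ j ∈ Finset.range (m + 1), Real.exp (-y) * y ^ j / j.factorial) <
      ∑ j ∈ Finset.range (m + 1), Real.exp (-x) * x ^ j / j.factorial :=
    fun m => strictAntiOn_poisson_cdf m hx hy hxy
  have h2 := Finset.sum_le_sum fun m (_ : m ∈ Finset.range k) => (h1 m).le
  have h3 := mul_le_mul_of_nonneg_left h2 (by positivity : (0 : ℝ) ≤ 1 / (k : ℝ))
  obtain ⟨k, rfl⟩ : ∃ k', k = k' + 1 := ⟨k - 1, by omega⟩
  have h4 := h1 k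
  simp only [poissonGap]
  linarith

theorem tendsto_poissonGap (k : ℕ) :
    Filter.Tendsto (poissonGap k) Filter.atTop (nhds (-1)) := by
  have h := ((tendsto_poisson_cdf k).add
    ((tendsto_finsetSum (Finset.range k) fun m _ => tendsto_poisson_cdf (m + 1)).const_mul
      (1 / (k : ℝ)))).sub_const 1
  rw [show (-1 : ℝ) = 0 + 1 / (k : ℝ) * ∑ m ∈ Finset.range k, 0 - 1 by simp]
  exact h

theorem existsUnique_isBalancedRate {k : ℕ} (hk : 0 < k) : ∃! lam : ℝ≥0, IsBalancedRate k lam := by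
  obtain ⟨b, hb, hb0⟩ : ∃ b, poissonGap k b < 0 ∧ 0 ≤ b :=
    (((tendsto_poissonGap k).eventually_lt_const (by norm_num : (-1 : ℝ) < 0)).and
      (Filter.eventually_ge_atTop 0)).exists
  obtain ⟨x, hx, hx0⟩ : (0 : ℝ) ∈ poissonGap k '' Set.Icc 0 b :=
    intermediate_value_Icc' hb0 (continuous_poissonGap k).continuousOn
      ⟨hb.le, by rw [poissonGap_zero hk]; exact zero_le_one⟩
  refine ⟨⟨x, hx.1⟩, (isBalancedRate_iff hk _).2 hx0, fun y hy => ?_⟩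
  refine NNReal.eq ((strictAntiOn_poissonGap hk).injOn y.2 hx.1 ?_)
  exact ((isBalancedRate_iff hk y).1 hy).trans hx0.symm

theorem IsBalancedRate.pos {k : ℕ} (hk : 0 < k) {lam : ℝ≥0} (h : IsBalancedRate k lam) :
    0 < lam := by
  rw [pos_iff_ne_zero]
  rintro rfl
  rw [isBalancedRate_iff hk, NNReal.coe_zero, poissonGap_zero hk] at h
  exact one_ne_zero h

/-! ### The Poisson law is the worst case -/

/-- Among bounded ultra-log-concave random variables with `δ_k = μ_k`, and the Poisson law with
this property, the Poisson law has the smallest `δ_k`. Were `δ_k` and `μ_k` of `X` both smaller,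
then `d j = Pr[X = j] - Pr[X^lam = j]` would have a negative sum over `j < k`, hence a positive
term at some `l ≥ k`, hence at most one sign change, from minus to plus, on `j < k`; such a sequence cannot
have `∑_{j < k} (k - j) * d j > 0`. -/
theorem delta_poisson_le_delta {Ω : Type*} [MeasurableSpace Ω] {P : Measure Ω}
    [IsProbabilityMeasure P] {X : Ω → ℕ} (hX : Measurable X) {N : ℕ} (hN : ∀ ω, X ω < N)
    (hulc : IsUltraLogConcave fun j => P.real {ω | X ω = j}) {k : ℕ} (hk : 0 < k)
    {lam : ℝ≥0} (hlam : IsBalancedRate k lam) (hbal : delta k P X = mu k P X) :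
    delta k (poissonMeasure lam) (fun x : ℕ => x) ≤ delta k P X := by
  by_contra! hlt
  have hlam0 : (0 : ℝ) < lam := hlam.pos hk
  have hmu : mu k P X < mu k (poissonMeasure lam) (fun x : ℕ => x) := by
    rw [← hbal, ← hlam]; exact hlt
  rw [mu_eq_sum hX hk, mu_eq_sum (X := fun x : ℕ => x) measurable_id hk] at hmu
  simp_rw [poissonMeasure_real_setOf_eq] at hmu
  -- `p` and `g` are the point masses of `X` and of the Poisson law
  obtain ⟨p, hp⟩ : ∃ p : ℕ → ℝ, p = fun j => P.real {ω | X ω = j} := ⟨_, rfl⟩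
  obtain ⟨g, hg⟩ : ∃ g : ℕ → ℝ, g = fun j => Real.exp (-lam) * (lam : ℝ) ^ j / j.factorial :=
    ⟨_, rfl⟩
  have hpoi : ∀ m, delta m (poissonMeasure lam) (fun x : ℕ => x) = ∑ j ∈ Finset.range m, g j := by
    intro m; rw [delta_poisson, hg]
  have hdel : ∀ m, delta m P X = ∑ j ∈ Finset.range m, p j := by
    intro m; rw [delta_eq_sum hX, hp]
  rw [hdel, hpoi] at hlt
  rw [← hp] at hulc
  have hweight : ∑ j ∈ Finset.range k, ((k : ℝ) - j) * g j <
      ∑ j ∈ Finset.range k, ((k : ℝ) - j) * p j := by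
    have hk' : (0 : ℝ) < 1 / (k : ℝ) := by positivity
    rw [hp, hg]
    exact lt_of_mul_lt_mul_left (by linarith) hk'.le
  -- both laws have mass at most one, that of `X` exactly one below `N`, so the deficit of `p` below
  -- `k` is made up for at or above `k`
  obtain ⟨l, hkl, hl⟩ : ∃ l, k ≤ l ∧ g l < p l := by
    have h1 : ∑ j ∈ Finset.range (max k N), p j = 1 := by
      rw [← hdel, delta, ← probReal_univ (μ := P)]
      congr 1
      ext ω
      simp [hN ω]
    have h2 : ∑ j ∈ Finset.range (max k N), g j ≤ 1 := by
      rw [← hpoi, delta]; exact measureReal_le_one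
    rw [← Finset.sum_range_add_sum_Ico _ (le_max_left k N)] at h1 h2
    obtain ⟨l, hl, hlt⟩ := Finset.exists_lt_of_sum_lt
      (by linarith : ∑ j ∈ Finset.Ico k (max k N), g j < ∑ j ∈ Finset.Ico k (max k N), p j)
    exact ⟨l, (Finset.mem_Ico.1 hl).1, hlt⟩
  have hconv : ∀ i j, i ≤ j → j ≤ l → g i ≤ p i → g j ≤ p j := by
    intro i j hij hjl hi
    have := hulc.poisson_le hlam0 hij hjl
    rw [hg] at hi hl ⊢
    exact this hi hl.le
  -- `m` is the place of the sign change of `p - g` on `j < k`, and `k` if there is none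
  obtain ⟨m, hmk, hneg, hpos⟩ : ∃ m ≤ k, (∀ j < m, p j ≤ g j) ∧ ∀ j, m ≤ j → j < k → g j ≤ p j := by
    by_cases h : ∃ i < k, g i ≤ p i
    · classical
      refine ⟨Nat.find h, (Nat.find_spec h).1.le, fun j hj => ?_, fun j hj hjk => ?_⟩
      · by_contra! hjp
        exact Nat.find_min h hj ⟨hj.trans (Nat.find_spec h).1, hjp.le⟩
      · exact hconv _ j hj (hjk.le.trans hkl) (Nat.find_spec h).2
    · push Not at h
      exact ⟨k, le_rfl, fun j hj => (h j hj).le, fun j h1 h2 => absurd h2 (not_lt.2 h1)⟩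
  have hterm : ∀ j ∈ Finset.range k, ((k : ℝ) - j) * (p j - g j) ≤ ((k : ℝ) - m) * (p j - g j) := by
    intro j hj
    rcases lt_or_ge j m with h | h
    · have h1 : (j : ℝ) ≤ m := by exact_mod_cast h.le
      exact mul_le_mul_of_nonpos_right (by linarith) (by linarith [hneg j h])
    · have h1 : (m : ℝ) ≤ j := by exact_mod_cast h
      exact mul_le_mul_of_nonneg_right (by linarith)
        (by linarith [hpos j h (Finset.mem_range.1 hj)])
  have hsum := Finset.sum_le_sum hterm
  simp_rw [mul_sub (_ - _)] at hsum
  rw [Finset.sum_sub_distrib, Finset.sum_sub_distrib, ← Finset.mul_sum, ← Finset.mul_sum,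
    ← mul_sub] at hsum
  have hmk' : (m : ℝ) ≤ k := by exact_mod_cast hmk
  nlinarith

/-! ### Demand -/

theorem demand_eq_sum {n : ℕ} (p : ℝ) (v : Fin n → ℝ) :
    demand p v = ∑ t, if p ≤ v t then 1 else 0 :=
  Finset.card_filter _ _

theorem demand_lt {n : ℕ} (p : ℝ) (v : Fin n → ℝ) : demand p v < n + 1 := by
  have := Finset.card_filter_le Finset.univ fun t => p ≤ v t
  rw [Finset.card_univ, Fintype.card_fin] at this
  exact Nat.lt_succ_of_le this

theorem measurable_demand {n : ℕ} (p : ℝ) : Measurable (demand (n := n) p) := by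
  have : demand (n := n) p = fun v => ∑ t, if p ≤ v t then 1 else 0 := funext (demand_eq_sum p)
  rw [this]
  exact Finset.measurable_sum _ fun t _ => Measurable.ite
    (measurableSet_le measurable_const (measurable_pi_apply t)) measurable_const measurable_const

theorem isProbabilityMeasure_valueLaw {n : ℕ} {F : Fin n → Measure ℝ}
    (hF : ∀ t, IsProbabilityMeasure (F t)) : IsProbabilityMeasure (valueLaw F) := by
  unfold valueLaw
  infer_instance

/-- The number of buyers who can afford the price is a sum of independent Bernoulli variables, so
its law is obtained from a point mass by convolving with Bernoulli laws. -/
theorem isUltraLogConcave_demand {n : ℕ} {F : Fin n → Measure ℝ}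
    (hF : ∀ t, IsProbabilityMeasure (F t)) (p : ℝ) :
    IsUltraLogConcave fun j => (valueLaw F).real {v | demand p v = j} := by
  induction n with
  | zero =>
    have := isProbabilityMeasure_valueLaw hF
    refine ⟨fun j => measureReal_nonneg, fun i j _ => ?_⟩
    have h : ∀ j : ℕ, {v : Fin 0 → ℝ | demand p v = j + 1} = ∅ := by
      intro j
      ext v
      simp [demand]
    simp [h]
  | succ n ih =>
    have h0 := isProbabilityMeasure_valueLaw (F := fun t => F (Fin.succ t)) fun t => hF _
    have hmp := measurePreserving_piFinSuccAbove F 0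
    have hd : ∀ v : Fin (n + 1) → ℝ, demand p v =
        (if p ≤ v 0 then 1 else 0) + demand p (fun t : Fin n => v t.succ) := by
      intro v
      rw [demand_eq_sum, demand_eq_sum, Fin.sum_univ_succ]
    have hprod : ∀ (A : Set ℝ) (B : Set (Fin n → ℝ)),
        MeasurableSet A → MeasurableSet B →
        (valueLaw F).real {v | v 0 ∈ A ∧ (fun t : Fin n => v t.succ) ∈ B} =
          (F 0).real A * (valueLaw fun t => F (Fin.succ t)).real B := by
      intro A B hA hB
      have := hmp.measureReal_preimage (hA.prod hB).nullMeasurableSet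
      rw [measureReal_prod_prod] at this
      exact this
    have hmeas : ∀ j : ℕ, MeasurableSet {v : Fin n → ℝ | demand p v = j} := fun j =>
      measurable_demand p (measurableSet_singleton j)
    have hcompl : (F 0).real (Set.Iio p) = 1 - (F 0).real (Set.Ici p) := by
      rw [← Set.compl_Ici, probReal_compl_eq_one_sub measurableSet_Ici]
    refine (ih (F := fun t => F (Fin.succ t)) fun t => hF _).bernoulli_conv
      (q := (F 0).real (Set.Ici p)) measureReal_nonneg measureReal_le_one ?_ ?_
    · rw [← hcompl, ← hprod _ _ measurableSet_Iio (hmeas 0)]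
      congr 1
      ext v
      simp only [Set.mem_ofPred_eq, hd, Set.mem_Iio]
      split_ifs with h
      · simp [not_lt.2 h]
      · simp [not_le.1 h]
    · intro j
      have := isProbabilityMeasure_valueLaw hF
      rw [← hcompl, ← hprod _ _ measurableSet_Iio (hmeas _),
        ← hprod _ _ measurableSet_Ici (hmeas _), ← measureReal_union]
      · congr 1
        ext v
        simp only [Set.mem_ofPred_eq, hd, Set.mem_Iio, Set.mem_Ici, Set.mem_union]
        split_ifs with h
        · simp [h, not_lt.2 h, add_comm 1]
        · simp [h, not_le.1 h]
      · rw [Set.disjoint_left]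
        exact fun v h1 h2 => not_le.2 (Set.mem_Iio.1 h1.1) h2.1
      · exact (measurableSet_Ici.preimage (measurable_pi_apply 0)).inter ((hmeas j).preimage
          (measurable_pi_lambda _ fun t => measurable_pi_apply _))

/-! ### Balanced prices -/

/-- The value of `1[x < k] - min(x, k) / k`, whose expectation at `x = X_p` is `δ_k - μ_k`. -/
noncomputable def gapFun (k x : ℕ) : ℝ :=
  (if x < k then 1 else 0) - 1 / (k : ℝ) * ((min x k : ℕ) : ℝ)

theorem abs_gapFun_le {k : ℕ} (hk : 0 < k) (x : ℕ) : |gapFun k x| ≤ 1 := by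
  have h1 : 1 / (k : ℝ) * ((min x k : ℕ) : ℝ) ≤ 1 := by
    rw [one_div_mul_eq_div, div_le_one (by positivity)]
    exact_mod_cast min_le_right _ _
  have h2 : 0 ≤ 1 / (k : ℝ) * ((min x k : ℕ) : ℝ) := by positivity
  rw [gapFun, abs_le]
  split_ifs <;> constructor <;> linarith

theorem gapFun_ne_zero {k : ℕ} (hk : 0 < k) (x : ℕ) : gapFun k x ≠ 0 := by
  have hk' : (0 : ℝ) < k := by exact_mod_cast hk
  rw [gapFun]
  split_ifs with h
  · have h' : (x : ℝ) < k := by exact_mod_cast h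
    rw [min_eq_left h.le, one_div_mul_eq_div, sub_ne_zero]
    exact ((div_lt_one hk').2 h').ne'
  · rw [min_eq_right (not_lt.1 h), one_div_mul_cancel hk'.ne']
    norm_num

section Balance

variable {n : ℕ} {F : Fin n → Measure ℝ}

theorem integrable_min_demand (hF : ∀ t, IsProbabilityMeasure (F t)) (k : ℕ) (p : ℝ) :
    Integrable (fun v : Fin n → ℝ => ((min (demand p v) k : ℕ) : ℝ)) (valueLaw F) := by
  have := isProbabilityMeasure_valueLaw hF
  refine Integrable.of_bound (C := k) ?_ (Filter.Eventually.of_forall fun v => ?_)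
  · exact ((measurable_from_top (f := fun x : ℕ => ((min x k : ℕ) : ℝ))).comp
      (measurable_demand p)).aestronglyMeasurable
  · rw [Real.norm_of_nonneg (by positivity)]
    exact_mod_cast min_le_right _ _

theorem isBalancedPrice_iff (hF : IsBuyerFamily F) (k : ℕ) (p : ℝ) :
    IsBalancedPrice k F p ↔ ∫ v, gapFun k (demand p v) ∂(valueLaw F) = 0 := by
  have := isProbabilityMeasure_valueLaw hF.prob
  have hset : MeasurableSet {v : Fin n → ℝ | demand p v < k} :=
    measurable_demand p (measurableSet_Iio (a := k))
  have hi1 : Integrable ({v : Fin n → ℝ | demand p v < k}.indicator (1 : (Fin n → ℝ) → ℝ))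
      (valueLaw F) := (integrable_const (1 : ℝ)).indicator hset
  have hi2 := integrable_min_demand hF.prob k p
  have hpt : ∀ v : Fin n → ℝ, gapFun k (demand p v) =
      {v : Fin n → ℝ | demand p v < k}.indicator (1 : (Fin n → ℝ) → ℝ) v -
        1 / (k : ℝ) * ((min (demand p v) k : ℕ) : ℝ) := by
    intro v
    rw [gapFun, Set.indicator_apply]
    rfl
  simp_rw [hpt]
  rw [integral_sub hi1 (hi2.const_mul _), integral_indicator_one hset, integral_const_mul,
    sub_eq_zero]
  rfl

theorem demand_eq_of_nonpos (hF : IsBuyerFamily F) {p : ℝ} (hp : p ≤ 0) :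
    ∀ᵐ v ∂(valueLaw F), demand p v = n := by
  have := hF.prob
  have h : ∀ t, ∀ᵐ v ∂(valueLaw F), 0 ≤ v t := by
    intro t
    have h0 : ∀ᵐ x ∂(F t), 0 ≤ x := by
      rw [ae_iff]
      simp only [not_le]
      exact hF.nonneg t
    exact (measurePreserving_eval F t).quasiMeasurePreserving.ae h0
  filter_upwards [ae_all_iff.2 h] with v hv
  rw [demand, Finset.filter_true_of_mem fun t _ => hp.trans (hv t), Finset.card_univ,
    Fintype.card_fin]

theorem integral_gapFun_of_nonpos (hF : IsBuyerFamily F) (k : ℕ) {p : ℝ} (hp : p ≤ 0) :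
    ∫ v, gapFun k (demand p v) ∂(valueLaw F) = gapFun k n := by
  have := isProbabilityMeasure_valueLaw hF.prob
  have h : (fun v => gapFun k (demand p v)) =ᵐ[valueLaw F] fun _ => gapFun k n := by
    filter_upwards [demand_eq_of_nonpos hF hp] with v hv
    rw [hv]
  rw [integral_congr_ae h]
  simp

/-- At a price that everyone accepts the gap is `gapFun k n`, which is not zero, so a balanced price
is positive. -/
theorem IsBalancedPrice.pos (hF : IsBuyerFamily F) {k : ℕ} (hk : 0 < k) {p : ℝ}
    (h : IsBalancedPrice k F p) : 0 < p := by
  by_contra! hp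
  rw [isBalancedPrice_iff hF, integral_gapFun_of_nonpos hF k hp] at h
  exact gapFun_ne_zero hk n h

theorem tendsto_integral_gapFun (hF : IsBuyerFamily F) {k : ℕ} (hk : 0 < k) {l : Filter ℝ}
    [l.IsCountablyGenerated] {d : (Fin n → ℝ) → ℕ}
    (h : ∀ᵐ v ∂(valueLaw F), ∀ᶠ p in l, demand p v = d v) :
    Filter.Tendsto (fun p => ∫ v, gapFun k (demand p v) ∂(valueLaw F)) l
      (nhds (∫ v, gapFun k (d v) ∂(valueLaw F))) := by
  have := isProbabilityMeasure_valueLaw hF.prob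
  refine tendsto_integral_filter_of_dominated_convergence (fun _ => 1) ?_ ?_
    (integrable_const _) ?_
  · exact Filter.Eventually.of_forall fun p =>
      ((measurable_from_top (f := gapFun k)).comp (measurable_demand p)).aestronglyMeasurable
  · exact Filter.Eventually.of_forall fun p => Filter.Eventually.of_forall fun v =>
      abs_gapFun_le hk _
  · filter_upwards [h] with v hv
    exact tendsto_const_nhds.congr' (hv.mono fun p hp => congrArg (gapFun k) hp.symm)

/-- Since the value distributions have no atoms, almost surely the demand is locally constant
around any given price. -/
theorem continuous_integral_gapFun (hF : IsBuyerFamily F) {k : ℕ} (hk : 0 < k) :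
    Continuous fun p => ∫ v, gapFun k (demand p v) ∂(valueLaw F) := by
  have := hF.prob
  rw [continuous_iff_continuousAt]
  intro p₀
  refine tendsto_integral_gapFun hF hk ?_
  have h : ∀ t, ∀ᵐ v ∂(valueLaw F), v t ≠ p₀ := by
    intro t
    have h0 : ∀ᵐ x ∂(F t), x ≠ p₀ := by
      rw [ae_iff]
      simpa using hF.atomless t p₀
    exact (measurePreserving_eval F t).quasiMeasurePreserving.ae h0
  filter_upwards [ae_all_iff.2 h] with v hv
  have h1 : ∀ t, ∀ᶠ p in nhds p₀, (p ≤ v t ↔ p₀ ≤ v t) := by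
    intro t
    rcases (hv t).lt_or_gt with h | h
    · filter_upwards [lt_mem_nhds h] with p hp
      simp [not_le.2 h, not_le.2 hp]
    · filter_upwards [gt_mem_nhds h] with p hp
      simp [h.le, le_of_lt hp]
  filter_upwards [Filter.eventually_all.2 h1] with p hp
  simp only [demand, hp]

/-- The gap `δ_k - μ_k` is continuous in the price; it equals `-1` at the price `0`, where at least
`k` buyers want a unit, and tends to `1` as the price grows. -/
theorem exists_isBalancedPrice (hF : IsBuyerFamily F) {k : ℕ} (hk : 0 < k) (hn : k < n) :
    ∃ p, IsBalancedPrice k F p := by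
  have hprob := isProbabilityMeasure_valueLaw hF.prob
  have hlim : Filter.Tendsto (fun p => ∫ v, gapFun k (demand p v) ∂(valueLaw F)) Filter.atTop
      (nhds 1) := by
    have h := tendsto_integral_gapFun (l := Filter.atTop) (d := fun _ => 0) hF hk
      (Filter.Eventually.of_forall fun v => ?_)
    · simpa [gapFun, hk] using h
    · filter_upwards [Filter.eventually_all.2 fun t => Filter.eventually_gt_atTop (v t)] with p hp
      simp [demand, hp]
  obtain ⟨b, hb, hb0⟩ := ((hlim.eventually_const_lt (zero_lt_one)).and
    (Filter.eventually_ge_atTop 0)).exists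
  have h0 : ∫ v, gapFun k (demand 0 v) ∂(valueLaw F) ≤ 0 := by
    rw [integral_gapFun_of_nonpos hF k le_rfl, gapFun, if_neg (not_lt.2 hn.le), zero_sub,
      neg_nonpos]
    positivity
  obtain ⟨p, -, hp⟩ := intermediate_value_Icc hb0
    (continuous_integral_gapFun hF hk).continuousOn ⟨h0, hb.le⟩
  exact ⟨p, (isBalancedPrice_iff hF k p).2 hp⟩

end Balance

/-! ### The order of arrival -/

theorem IsBuyerFamily.perm {n : ℕ} {F : Fin n → Measure ℝ} (hF : IsBuyerFamily F)
    (σ : Equiv.Perm (Fin n)) : IsBuyerFamily fun t => F (σ t) :=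
  ⟨fun _ => hF.prob _, fun _ => hF.atomless _, fun _ => hF.nonneg _⟩

theorem isBalancedPrice_perm {n : ℕ} {F : Fin n → Measure ℝ} (hF : IsBuyerFamily F)
    (σ : Equiv.Perm (Fin n)) {k : ℕ} {p : ℝ} (h : IsBalancedPrice k F p) :
    IsBalancedPrice k (fun t => F (σ t)) p := by
  have := hF.prob
  rw [isBalancedPrice_iff (hF.perm σ)]
  rw [isBalancedPrice_iff hF] at h
  have hmp := measurePreserving_piCongrLeft F σ
  rw [← h, valueLaw, valueLaw, ← hmp.integral_comp']
  congr 1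
  ext v
  rw [demand_eq_sum, demand_eq_sum]
  refine congrArg _ ((Finset.sum_congr rfl fun t _ => ?_).trans (Equiv.sum_comp σ _))
  rw [MeasurableEquiv.piCongrLeft_apply_apply σ (β := fun _ => ℝ)]

/-! ### Welfare and optimum -/

/-- The number of buyers other than `t` whose value is at least `p`. -/
noncomputable def othersDemand {n : ℕ} (p : ℝ) (t : Fin n) (v : Fin n → ℝ) : ℕ :=
  ∑ s ∈ Finset.univ.erase t, if p ≤ v s then 1 else 0

theorem othersDemand_le_demand {n : ℕ} (p : ℝ) (t : Fin n) (v : Fin n → ℝ) :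
    othersDemand p t v ≤ demand p v := by
  rw [demand_eq_sum]
  exact Finset.sum_le_sum_of_subset (Finset.erase_subset _ _)

theorem othersDemand_lt {n : ℕ} (p : ℝ) (t : Fin n) (v : Fin n → ℝ) : othersDemand p t v < n := by
  have h : othersDemand p t v ≤ ∑ s ∈ Finset.univ.erase t, 1 :=
    Finset.sum_le_sum fun s _ => by split_ifs <;> simp
  rw [Finset.sum_const, Finset.card_erase_of_mem (Finset.mem_univ t), Finset.card_univ,
    Fintype.card_fin, smul_eq_mul, mul_one] at h
  have := t.2
  omega

/-- The number of buyers among the first `m` whose value is at least `p`. -/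
noncomputable def demandBefore {n : ℕ} (p : ℝ) (v : Fin n → ℝ) (m : ℕ) : ℕ :=
  open Classical in ∑ s ∈ Finset.range m, if ∃ h : s < n, p ≤ v ⟨s, h⟩ then 1 else 0

theorem demandBefore_succ {n : ℕ} (p : ℝ) (v : Fin n → ℝ) (m : ℕ)
    [Decidable (∃ h : m < n, p ≤ v ⟨m, h⟩)] :
    demandBefore p v (m + 1) =
      demandBefore p v m + if ∃ h : m < n, p ≤ v ⟨m, h⟩ then 1 else 0 := by
  rw [demandBefore, Finset.sum_range_succ, ← demandBefore]
  congr

theorem demandBefore_eq_demand {n : ℕ} (p : ℝ) (v : Fin n → ℝ) :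
    demandBefore p v n = demand p v := by
  rw [demandBefore, demand_eq_sum, Finset.sum_range]
  exact Finset.sum_congr rfl fun t _ => by simp

theorem demandBefore_le_othersDemand {n : ℕ} (p : ℝ) (v : Fin n → ℝ) (t : Fin n) :
    demandBefore p v t ≤ othersDemand p t v := by
  classical
  have h1 : demandBefore p v t = ∑ s ∈ Finset.range t,
      if s = t then 0 else if ∃ h : s < n, p ≤ v ⟨s, h⟩ then 1 else 0 := by
    rw [demandBefore]
    refine Finset.sum_congr rfl fun s hs => ?_
    rw [if_neg (Finset.mem_range.1 hs).ne]
  have h2 : othersDemand p t v = ∑ s ∈ Finset.range n,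
      if s = t then 0 else if ∃ h : s < n, p ≤ v ⟨s, h⟩ then 1 else 0 := by
    rw [othersDemand, Finset.sum_range, ← Finset.filter_ne', Finset.sum_filter]
    refine Finset.sum_congr rfl fun s _ => ?_
    by_cases h : s = t
    · simp [h]
    · simp [h, Fin.val_inj]
  rw [h1, h2]
  exact Finset.sum_le_sum_of_subset (Finset.range_mono t.2.le)

/-- The supply is what the earlier demand leaves, by truncated subtraction. -/
theorem supply_eq {n : ℕ} (p : ℝ) (k : ℕ) (v : Fin n → ℝ) (m : ℕ) :
    supply p k v m = k - demandBefore p v m := by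
  classical
  induction m with
  | zero => simp [supply, demandBefore]
  | succ m ih =>
    rw [supply, demandBefore_succ, ih]
    by_cases h : ∃ h : m < n, p ≤ v ⟨m, h⟩
    · rw [if_pos h]
      split_ifs <;> grind
    · rw [if_neg h, if_neg fun h' => h h'.2, add_zero]

/-- The number of sales is `min(X_p, k)`. -/
theorem sum_sales {n : ℕ} (p : ℝ) (k : ℕ) (v : Fin n → ℝ) :
    (∑ t : Fin n, if 0 < supply p k v t ∧ p ≤ v t then 1 else 0) = min (demand p v) k := by
  classical
  have h : ∀ m, (∑ s ∈ Finset.range m,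
      if 0 < supply p k v s ∧ ∃ h : s < n, p ≤ v ⟨s, h⟩ then 1 else 0) =
      min (demandBefore p v m) k := by
    intro m
    induction m with
    | zero => simp [demandBefore]
    | succ m ih =>
      rw [Finset.sum_range_succ, ih, demandBefore_succ, supply_eq]
      by_cases h : ∃ h : m < n, p ≤ v ⟨m, h⟩
      · simp only [h, and_true, if_true]
        split_ifs <;> grind
      · simp [h]
  rw [← demandBefore_eq_demand, ← h, Finset.sum_range]
  exact Finset.sum_congr rfl fun t _ => by simp

/-- The welfare splits into the revenue `p * min(X_p, k)` and the utilities `v t - p` of the buyers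
served. A buyer is certain to find a unit left if fewer than `k` of the others can afford the price,
whatever the order of arrival. -/
theorem realizedWelfare_ge {n : ℕ} {p : ℝ} (hp : 0 ≤ p) (k : ℕ) (v : Fin n → ℝ) :
    ENNReal.ofReal p * ((min (demand p v) k : ℕ) : ℝ≥0∞) +
      ∑ t, {v | othersDemand p t v < k}.indicator 1 v * ENNReal.ofReal (v t - p) ≤
    ENNReal.ofReal (realizedWelfare p k v) := by
  have h1 : ∀ t : Fin n, (if 0 < supply p k v t ∧ p ≤ v t then v t else 0) =
      p * ((if 0 < supply p k v t ∧ p ≤ v t then 1 else 0 : ℕ) : ℝ) +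
        if 0 < supply p k v t then max (v t - p) 0 else 0 := by
    intro t
    by_cases hs : 0 < supply p k v t
    · rcases le_or_gt p (v t) with h | h
      · simp [hs, h]
      · simp [hs, not_le.2 h, h.le]
    · simp [hs]
  have h2 : realizedWelfare p k v = p * ((min (demand p v) k : ℕ) : ℝ) +
      ∑ t : Fin n, if 0 < supply p k v t then max (v t - p) 0 else 0 := by
    rw [realizedWelfare, Finset.sum_congr rfl fun t _ => h1 t, Finset.sum_add_distrib,
      ← Finset.mul_sum, ← Nat.cast_sum, sum_sales]
  have h3 : ∀ t : Fin n, 0 ≤ if 0 < supply p k v t then max (v t - p) 0 else 0 := by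
    intro t
    split_ifs
    · exact le_max_right _ _
    · exact le_rfl
  rw [h2, ENNReal.ofReal_add (by positivity) (Finset.sum_nonneg fun t _ => h3 t),
    ENNReal.ofReal_mul hp, ENNReal.ofReal_natCast, ENNReal.ofReal_sum_of_nonneg fun t _ => h3 t]
  refine add_le_add le_rfl (Finset.sum_le_sum fun t _ => ?_)
  by_cases h : othersDemand p t v < k
  · have hs : 0 < supply p k v t := by
      have := demandBefore_le_othersDemand p v t
      rw [supply_eq]
      omega
    rw [if_pos hs, Set.indicator_of_mem (by exact h), Pi.one_apply, one_mul]
    exact ENNReal.ofReal_le_ofReal (le_max_left _ _)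
  · rw [Set.indicator_of_notMem (by exact h), zero_mul]
    exact zero_le

/-- Each of the at most `k` values in the sum is at most `p + (v t - p)⁺`. -/
theorem topSum_le {n : ℕ} {p : ℝ} (hp : 0 ≤ p) (k : ℕ) (v : Fin n → ℝ) :
    topSum k v ≤ k * p + ∑ t, max (v t - p) 0 := by
  obtain ⟨l, hl⟩ : ∃ l, l = (Finset.univ.val.map v).sort (fun a b : ℝ => b ≤ a) := ⟨_, rfl⟩
  have hsum : ∑ t, max (v t - p) 0 = (l.map fun x => max (x - p) 0).sum := by
    rw [← Multiset.sum_coe, ← Multiset.map_coe, hl, Multiset.sort_eq, Multiset.map_map]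
    rfl
  have hlist : ∀ l : List ℝ, l.sum ≤ l.length * p + (l.map fun x => max (x - p) 0).sum := by
    intro l
    induction l with
    | nil => simp
    | cons x l ih =>
      simp only [List.sum_cons, List.length_cons, List.map_cons, Nat.cast_succ]
      linarith [le_max_left (x - p) 0]
  rw [topSum, ← hl, hsum]
  refine (hlist _).trans (add_le_add ?_ ?_)
  · refine mul_le_mul_of_nonneg_right ?_ hp
    exact_mod_cast List.length_take_le k l
  · refine ((List.take_sublist k l).map _).sum_le_sum fun x hx => ?_
    obtain ⟨y, -, rfl⟩ := List.mem_map.1 hx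
    exact le_max_right _ _

section Expectation

variable {n : ℕ} {F : Fin n → Measure ℝ}

theorem lintegral_ofReal_eval_sub (hF : ∀ t, IsProbabilityMeasure (F t)) (t : Fin n) (p : ℝ) :
    ∫⁻ v, ENNReal.ofReal (v t - p) ∂(valueLaw F) = ∫⁻ x, ENNReal.ofReal (x - p) ∂(F t) :=
  (measurePreserving_eval F t).lintegral_comp (f := fun x => ENNReal.ofReal (x - p)) (by fun_prop)

theorem opt_le (hF : ∀ t, IsProbabilityMeasure (F t)) {p : ℝ} (hp : 0 ≤ p) (k : ℕ) :
    opt k F ≤ k * ENNReal.ofReal p + ∑ t, ∫⁻ x, ENNReal.ofReal (x - p) ∂(F t) := by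
  have := isProbabilityMeasure_valueLaw hF
  calc opt k F
      ≤ ∫⁻ v, (k * ENNReal.ofReal p + ∑ t, ENNReal.ofReal (v t - p)) ∂(valueLaw F) := by
        refine lintegral_mono fun v => (ENNReal.ofReal_le_ofReal (topSum_le hp k v)).trans ?_
        rw [ENNReal.ofReal_add (by positivity) (Finset.sum_nonneg fun t _ => le_max_right _ _),
          ENNReal.ofReal_mul (by positivity), ENNReal.ofReal_natCast,
          ENNReal.ofReal_sum_of_nonneg fun t _ => le_max_right _ _]
        simp [ENNReal.ofReal_max]
    _ = _ := by
        rw [lintegral_add_left measurable_const, lintegral_const, measure_univ, mul_one,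
          lintegral_finsetSum _ fun t _ => by fun_prop]
        simp_rw [lintegral_ofReal_eval_sub hF]

theorem measurable_othersDemand (p : ℝ) (t : Fin n) : Measurable (othersDemand p t) :=
  Finset.measurable_sum _ fun s _ => Measurable.ite
    (measurableSet_le measurable_const (measurable_pi_apply s)) measurable_const measurable_const

theorem indepFun_othersDemand (hF : ∀ t, IsProbabilityMeasure (F t)) (p : ℝ) (t : Fin n) :
    IndepFun (othersDemand p t) (fun v => v t) (valueLaw F) := by
  have h := (iIndepFun_pi (μ := F) (X := fun _ => id) fun _ => aemeasurable_id).indepFun_finset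
    (Finset.univ.erase t) {t} (by simp) (fun i => measurable_pi_apply i)
  have h1 : Measurable fun w : ↥(Finset.univ.erase t) → ℝ =>
      ∑ s, if p ≤ w s then 1 else 0 :=
    Finset.measurable_sum _ fun s _ => Measurable.ite
      (measurableSet_le measurable_const (measurable_pi_apply s)) measurable_const measurable_const
  have h2 := h.comp h1 (measurable_pi_apply
    (⟨t, Finset.mem_singleton_self t⟩ : ({t} : Finset (Fin n))))
  convert! h2 using 1
  ext v
  exact (Finset.sum_coe_sort (Finset.univ.erase t) fun s => if p ≤ v s then 1 else 0).symm

theorem welfare_ge (hF : ∀ t, IsProbabilityMeasure (F t)) {p : ℝ} (hp : 0 ≤ p) (k : ℕ) :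
    ENNReal.ofReal p * ∫⁻ v, ((min (demand p v) k : ℕ) : ℝ≥0∞) ∂(valueLaw F) +
      ∑ t, valueLaw F {v | othersDemand p t v < k} * ∫⁻ x, ENNReal.ofReal (x - p) ∂(F t) ≤
    welfare p k F := by
  have hmin : Measurable fun v : Fin n → ℝ => ((min (demand p v) k : ℕ) : ℝ≥0∞) :=
    (measurable_from_top (f := fun x : ℕ => ((min x k : ℕ) : ℝ≥0∞))).comp (measurable_demand p)
  have hset : ∀ t : Fin n, MeasurableSet {v : Fin n → ℝ | othersDemand p t v < k} := fun t =>
    measurable_othersDemand p t (measurableSet_Iio (a := k))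
  have hind : ∀ t : Fin n, Measurable
      ({v : Fin n → ℝ | othersDemand p t v < k}.indicator (1 : (Fin n → ℝ) → ℝ≥0∞)) := fun t =>
    measurable_one.indicator (hset t)
  have hprod : ∀ t : Fin n, ∫⁻ v, {v : Fin n → ℝ | othersDemand p t v < k}.indicator 1 v *
      ENNReal.ofReal (v t - p) ∂(valueLaw F) =
      valueLaw F {v | othersDemand p t v < k} * ∫⁻ x, ENNReal.ofReal (x - p) ∂(F t) := by
    intro t
    have h := (indepFun_othersDemand hF p t).comp
      (measurable_from_top (f := (Set.Iio k).indicator (1 : ℕ → ℝ≥0∞)))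
      (by fun_prop : Measurable fun x : ℝ => ENNReal.ofReal (x - p))
    rw [← lintegral_indicator_one (hset t), ← lintegral_ofReal_eval_sub hF]
    exact lintegral_mul_eq_lintegral_mul_lintegral_of_indepFun'' (hind t).aemeasurable
      (by fun_prop : Measurable fun v : Fin n → ℝ => ENNReal.ofReal (v t - p)).aemeasurable h
  refine le_trans (le_of_eq ?_) (lintegral_mono fun v => realizedWelfare_ge hp k v)
  rw [lintegral_add_left (hmin.const_mul _), lintegral_const_mul _ hmin,
    lintegral_finsetSum _ fun t _ => (hind t).fun_mul (by fun_prop)]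
  simp_rw [hprod]

theorem lintegral_min_demand (hF : ∀ t, IsProbabilityMeasure (F t)) {k : ℕ} (hk : 0 < k) (p : ℝ) :
    ∫⁻ v, ((min (demand p v) k : ℕ) : ℝ≥0∞) ∂(valueLaw F) =
      k * ENNReal.ofReal (mu k (valueLaw F) (demand p)) := by
  have := isProbabilityMeasure_valueLaw hF
  have hk' : (k : ℝ) ≠ 0 := by positivity
  have hint := integrable_min_demand hF k p
  rw [← ENNReal.ofReal_natCast, ← ENNReal.ofReal_mul (by positivity), mu, ← mul_assoc,
    mul_one_div_cancel hk', one_mul,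
    ofReal_integral_eq_lintegral_ofReal hint (Filter.Eventually.of_forall fun v => by positivity)]
  simp_rw [ENNReal.ofReal_natCast]

/-- A balanced price guarantees the fraction `δ_k(X_p) = μ_k(X_p)` of the optimum: `μ_k` is the
fraction of the revenue term `k * p`, and `δ_k` that of the utility term `∑ t, E[(v t - p)⁺]`. -/
theorem IsBalancedPrice.delta_mul_opt_le (hF : IsBuyerFamily F) {k : ℕ} (hk : 0 < k) {p : ℝ}
    (h : IsBalancedPrice k F p) (σ : Equiv.Perm (Fin n)) :
    ENNReal.ofReal (delta k (valueLaw fun t => F (σ t)) (demand p)) * opt k F ≤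
      welfare p k fun t => F (σ t) := by
  have hp := (h.pos hF hk).le
  have hσ := hF.perm σ
  have := isProbabilityMeasure_valueLaw hσ.prob
  have hb := isBalancedPrice_perm hF σ h
  refine le_trans ?_ (welfare_ge hσ.prob hp k)
  refine (mul_le_mul_right (opt_le hF.prob hp k) _).trans ?_
  rw [mul_add]
  refine add_le_add (le_of_eq ?_) ?_
  · rw [lintegral_min_demand hσ.prob hk, ← hb]
    ring
  · rw [← Equiv.sum_comp σ fun t => ∫⁻ x, ENNReal.ofReal (x - p) ∂(F t), Finset.mul_sum]
    refine Finset.sum_le_sum fun t _ => mul_le_mul_left ?_ _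
    rw [delta, ofReal_measureReal]
    exact measure_mono fun v hv => (othersDemand_le_demand p t v).trans_lt hv

/-- With at most `k` buyers, everyone finds a unit left, so the price `0` attains the optimum. -/
theorem opt_le_welfare_zero (hF : IsBuyerFamily F) {k : ℕ} (hn : n ≤ k)
    (σ : Equiv.Perm (Fin n)) : opt k F ≤ welfare 0 k fun t => F (σ t) := by
  have hσ := hF.perm σ
  have := isProbabilityMeasure_valueLaw hσ.prob
  refine (opt_le hF.prob le_rfl k).trans (le_trans ?_ (welfare_ge hσ.prob le_rfl k))
  refine add_le_add (by simp) (le_of_eq ?_)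
  rw [← Equiv.sum_comp σ fun t => ∫⁻ x, ENNReal.ofReal (x - 0) ∂(F t)]
  refine Finset.sum_congr rfl fun t _ => ?_
  have huniv : {v : Fin n → ℝ | othersDemand 0 t v < k} = Set.univ :=
    Set.eq_univ_of_forall fun v => (othersDemand_lt 0 t v).trans_le hn
  rw [huniv, measure_univ, one_mul]

/-- The law of `X_p` is ultra-log-concave, so the fraction `δ_k(X_p)` guaranteed by a balanced price
is at least that of the balanced Poisson law. -/
theorem IsSchemePrice.guarantee (hF : IsBuyerFamily F) {k : ℕ} (hk : 0 < k) {lam : ℝ≥0}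
    (hlam : IsBalancedRate k lam) {p : ℝ} (h : IsSchemePrice k F p) (σ : Equiv.Perm (Fin n)) :
    ENNReal.ofReal (delta k (poissonMeasure lam) (fun x : ℕ => x)) * opt k F ≤
      welfare p k fun t => F (σ t) := by
  rcases h with h | ⟨hn, rfl⟩
  · have hσ := hF.perm σ
    have := isProbabilityMeasure_valueLaw hσ.prob
    refine le_trans (mul_le_mul_left (ENNReal.ofReal_le_ofReal ?_) _) (h.delta_mul_opt_le hF hk σ)
    exact delta_poisson_le_delta (measurable_demand p) (demand_lt p)
      (isUltraLogConcave_demand hσ.prob p) hk hlam (isBalancedPrice_perm hF σ h)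
  · refine le_trans ?_ (opt_le_welfare_zero hF hn σ)
    refine mul_le_of_le_one_left' ?_
    rw [delta, ofReal_measureReal]
    exact prob_le_one

end Expectation

end StaticPricing

theorem mainTheorem1 (k : ℕ) (hk : 0 < k) :
    (∃! lam : ℝ≥0, StaticPricing.IsBalancedRate k lam) ∧
    ∀ lam : ℝ≥0, StaticPricing.IsBalancedRate k lam →
      -- every instance: prices of the scheme exist, and each of them has the guarantee,
      -- whatever the order of arrival
      (∀ (n : ℕ) (F : Fin n → Measure ℝ), StaticPricing.IsBuyerFamily F →
        (k < n → ∃ p : ℝ, StaticPricing.IsBalancedPrice k F p) ∧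
        ∀ p : ℝ, StaticPricing.IsSchemePrice k F p → ∀ σ : Equiv.Perm (Fin n),
          ENNReal.ofReal
              (StaticPricing.delta k (poissonMeasure lam) (fun x : ℕ => x)) *
            StaticPricing.opt k F ≤ StaticPricing.welfare p k (fun t => F (σ t))) ∧
      -- the competitive ratio of the scheme
      (∀ s : StaticPricing.PricingScheme,
        (∀ (n : ℕ) (F : Fin n → Measure ℝ), StaticPricing.IsBuyerFamily F →
          StaticPricing.IsSchemePrice k F (s k n F)) →
        ENNReal.ofReal (StaticPricing.delta k (poissonMeasure lam) (fun x : ℕ => x)) ≤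
          StaticPricing.compRatio s k) := by
  refine ⟨StaticPricing.existsUnique_isBalancedRate hk, fun lam hlam =>
    ⟨fun n F hF => ⟨StaticPricing.exists_isBalancedPrice hF hk, fun p hp σ =>
      hp.guarantee hF hk hlam σ⟩, fun s hs => ?_⟩⟩
  refine le_iInf fun n => le_iInf fun F => le_iInf fun hF => le_iInf fun h0 =>
    le_iInf fun htop => ?_
  rw [ENNReal.le_div_iff_mul_le (Or.inl h0) (Or.inl htop)]
  exact (hs n F hF).guarantee hF hk hlam (Equiv.refl _)
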